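/- Let $n\ge 2$. For $k\in SO(n)$ and a real symmetric matrix $X\in\mathrm{Sym}_n(\mathbb R)$ write $k.X=kXk^{-1}$, let $\Pi:\mathrm{Sym}_n(\mathbb R)\to\mathrm{Sym}_{n-1}(\mathbb R)$ be the projection to the upper-left $(n-1)\times(n-1)$ submatrix, and let $dk$, $dk'$ be the Haar probability measures on $SO(n)$ and $SO(n-1)$. There is a constant $c_n>0$, depending only on $n$, with the following property. Let $\lambda=\mathrm{diag}(\lambda_1,\dots,\lambda_n)$ with $\lambda_1<\lambda_2<\dots<\lambda_n$ real, put $$\mathcal M=\{\mathrm{diag}(\mu_1,\dots,\mu_{n-1}) : \lambda_i<\mu_i<\lambda_{i+1}\text{ for }1\le i\le n-1\},$$ and for $\mu\in\mathcal M$ put $$J(\mu)=\frac{\prod_{1\le i<j\le n-1}|\mu_i-\mu_j|}{\prod_{1\le i\le n,\ 1\le j\le n-1}|\lambda_i-\mu_j|^{1/2}}.$$ Then for every non-negative Borel measurable function $f:\mathrm{Sym}_{n-1}(\mathbb R)\to\mathbb R$, $$\int_{SO(n)} f(\Pi(k.\lambda))\,dk = c_n\int_{\mathcal M}\left(\int_{SO(n-1)}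 f(k'.\mu)\,dk'\right)J(\mu)\,d\mu,$$ as an equality in $[0,\infty]$, where $d\mu=d\mu_1\cdots d\mu_{n-1}$ is Lebesgue measure. -/

import Mathlib

open MeasureTheory

noncomputable section

namespace Corner

/-- The Borel (product) sigma-algebra on real matrices. -/
instance instMeasurableSpaceMatrix (m n : ℕ) :
    MeasurableSpace (Matrix (Fin m) (Fin n) ℝ) :=
  inferInstanceAs (MeasurableSpace (Fin m → Fin n → ℝ))

instance instBorelSpaceMatrix (m n : ℕ) : BorelSpace (Matrix (Fin m) (Fin n) ℝ) :=
  inferInstanceAs (BorelSpace (Fin m → Fin n → ℝ))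

/-- The group `SO(n)`, with the topology and Borel structure induced from real matrices. -/
abbrev SO (n : ℕ) : Type := Matrix.specialOrthogonalGroup (Fin n) ℝ

/-- The space of real symmetric `n × n` matrices. -/
abbrev SymMat (n : ℕ) : Type := {X : Matrix (Fin n) (Fin n) ℝ // X.IsSymm}

theorem SO.coe_inv {n : ℕ} (k : SO n) :
    ((k⁻¹ : SO n) : Matrix (Fin n) (Fin n) ℝ) = (k : Matrix (Fin n) (Fin n) ℝ).transpose :=
  rfl

instance instIsTopologicalGroupSO (n : ℕ) : IsTopologicalGroup (SO n) where
  continuous_inv :=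
    Continuous.subtype_mk (continuous_subtype_val.matrix_transpose) _

theorem SO.isCompact (n : ℕ) :
    IsCompact (Matrix.specialOrthogonalGroup (Fin n) ℝ : Set (Matrix (Fin n) (Fin n) ℝ)) := by
  have hbox : IsCompact (Set.univ.pi fun _ => Set.univ.pi fun _ => Set.Icc (-1) 1 :
      Set (Fin n → Fin n → ℝ)) :=
    isCompact_univ_pi fun _ => isCompact_univ_pi fun _ => isCompact_Icc
  have hset : (Matrix.specialOrthogonalGroup (Fin n) ℝ : Set (Matrix (Fin n) (Fin n) ℝ)) =
      {A | A * A.transpose = 1} ∩ {A | A.det = 1} := by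
    ext A
    exact Matrix.mem_specialOrthogonalGroup_iff.trans
      (and_congr_left' (Matrix.mem_orthogonalGroup_iff (Fin n) ℝ))
  have hclosed : IsClosed
      ({A | A * A.transpose = 1} ∩ {A | A.det = 1} : Set (Matrix (Fin n) (Fin n) ℝ)) :=
    (isClosed_eq (by fun_prop) continuous_const).inter
      (isClosed_eq (by fun_prop) continuous_const)
  rw [hset]
  refine IsCompact.of_isClosed_subset (X := Matrix (Fin n) (Fin n) ℝ) hbox hclosed ?_
  rintro A ⟨hA, -⟩ i - j -
  have h : ∑ l, A i l * A i l = 1 := by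
    have := congrFun (congrFun hA i) i
    simpa [Matrix.mul_apply] using this
  have h2 : A i j * A i j ≤ 1 := by
    rw [← h]
    exact Finset.single_le_sum (f := fun l => A i l * A i l)
      (fun l _ => mul_self_nonneg _) (Finset.mem_univ j)
  exact ⟨by nlinarith, by nlinarith⟩

instance instCompactSpaceSO (n : ℕ) : CompactSpace (SO n) :=
  isCompact_iff_compactSpace.mp (SO.isCompact n)

/-- The Haar measure on `SO(n)`, normalized to have total mass one. -/
def haarSO (n : ℕ) : Measure (SO n) := Measure.haarMeasure ⊤

/-- The adjoint action `k.X = k X k⁻¹` of `SO(n)` on symmetric matrices. -/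
def act {n : ℕ} (k : SO n) (X : SymMat n) : SymMat n :=
  ⟨(k : Matrix (Fin n) (Fin n) ℝ) * X.1 * ((k⁻¹ : SO n) : Matrix (Fin n) (Fin n) ℝ), by
    rw [SO.coe_inv]
    simp [Matrix.IsSymm, Matrix.transpose_mul, Matrix.mul_assoc, X.2.eq]⟩

/-- The diagonal matrix with diagonal `v`. -/
def diag {n : ℕ} (v : Fin n → ℝ) : SymMat n :=
  ⟨Matrix.diagonal v, Matrix.isSymm_diagonal v⟩

/-- The projection to the upper left block, deleting the last row and the last column. -/
def block {m : ℕ} (X : SymMat (m + 1)) : SymMat m :=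
  ⟨X.1.submatrix Fin.castSucc Fin.castSucc, X.2.submatrix _⟩

/-- The set of `μ` with `lam i < μ i < lam (i + 1)` for every `i`; the point `μ` stands for the
diagonal matrix `diag μ`. -/
def interlacing {m : ℕ} (lam : Fin (m + 1) → ℝ) : Set (Fin m → ℝ) :=
  {μ | ∀ i : Fin m, lam i.castSucc < μ i ∧ μ i < lam i.succ}

/-- The weight `∏_{i < j} |μ i - μ j| / ∏_{i, j} |lam i - μ j| ^ (1/2)`. -/
def weight {m : ℕ} (lam : Fin (m + 1) → ℝ) (μ : Fin m → ℝ) : ℝ :=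
  (∏ i : Fin m, ∏ j ∈ Finset.Ioi i, |μ i - μ j|) /
    ∏ i : Fin (m + 1), ∏ j : Fin m, |lam i - μ j| ^ (1 / 2 : ℝ)

end Corner

end

/-!
The corner `Π(k.λ)` is studied in three steps.

*Reduction to eigenvalues.* `SO(m)` embeds into `SO(m + 1)` as the stabilizer of the last basis
vector, and its action commutes with taking the corner. Hence, by invariance of Haar measure, `f`
may be replaced by its average over `SO(m)`-orbits (`lintegral_orbitAverage_block`), and then only
the orbit of the corner matters. For simple spectrum that orbit is determined by the
characteristic polynomial (`exists_act_diag_of_charpoly_eq`).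

*The characteristic polynomial of the corner.* If `v` is the last row of `k`, computing an
adjugate gives `χ(λ i) = v i ^ 2 ∏_{j ≠ i} (λ i - λ j)` (`eval_charpoly_block`). So the numbers
`v i ^ 2` are the residues at the nodes `λ i` of `∏ⱼ (x - μ j) / ∏ᵢ (x - λ i)`, where `μ` are the
eigenvalues of the corner.

*Change of variables.* The vector `v` is uniform on the sphere, so its law is found by integrating
functions that are homogeneous of degree zero over the unit ball (`setLIntegral_unitBall_eq`). On
`ℝ ^ (m + 1)` the squares `x i ^ 2` have density `∏ y i ^ (-1/2)`, and `y` is parametrized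
bijectively by a scale `s > 0` and an interlacing `μ`, as the residues of
`s ∏ⱼ (x - μ j) / ∏ᵢ (x - λ i)` (`image_residueMap`, `residueMap_injOn`). The Jacobian
is `s ^ m` times a quotient of the
Vandermonde products of `μ` and `λ` (`abs_det_residueJacobian`). Together with the density this
leaves exactly the weight, times a power of `s`, and no further dependence on `λ`
(`abs_det_residueJacobian_mul`). The constant is therefore a radial integral divided by the volume
of the unit ball.
-/

namespace Corner

/-! ### Haar measure on `SO(n)` and orbit averages -/

instance (m n : ℕ) : SecondCountableTopology (Matrix (Fin m) (Fin n) ℝ) :=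
  inferInstanceAs (SecondCountableTopology (Fin m → Fin n → ℝ))

instance (n : ℕ) : SecondCountableTopology (SymMat n) :=
  TopologicalSpace.Subtype.secondCountableTopology _

instance (n : ℕ) : SecondCountableTopology (SO n) :=
  TopologicalSpace.Subtype.secondCountableTopology _

instance (n : ℕ) : IsProbabilityMeasure (haarSO n) where
  measure_univ := by
    have h := Measure.haarMeasure_self (K₀ := (⊤ : TopologicalSpace.PositiveCompacts (SO n)))
    simpa [haarSO] using h

instance (n : ℕ) : (haarSO n).IsHaarMeasure :=
  inferInstanceAs (Measure.haarMeasure ⊤).IsHaarMeasure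

instance (n : ℕ) : (haarSO n).IsMulRightInvariant where
  map_mul_right_eq_self g := by
    -- A right translate of the Haar probability measure is again one; these are unique.
    have : IsProbabilityMeasure (Measure.map (· * g) (haarSO n)) :=
      Measure.isProbabilityMeasure_map (by fun_prop)
    exact Measure.isHaarMeasure_eq_of_isProbabilityMeasure _ _

theorem act_mul {n : ℕ} (k l : SO n) (X : SymMat n) : act (k * l) X = act k (act l X) := by
  apply Subtype.ext
  simp [act, SO.coe_inv, Matrix.mul_assoc, Matrix.transpose_mul, -mul_inv_rev]

theorem measurable_act (n : ℕ) : Measurable fun p : SO n × SymMat n => act p.1 p.2 := by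
  have : Continuous fun p : SO n × SymMat n => act p.1 p.2 := by
    refine Continuous.subtype_mk ?_ _
    simp only [SO.coe_inv]
    fun_prop
  exact this.measurable

theorem measurable_act_left {n : ℕ} (X : SymMat n) : Measurable fun k : SO n => act k X := by
  have : Continuous fun k : SO n => act k X := by
    refine Continuous.subtype_mk ?_ _
    simp only [SO.coe_inv]
    fun_prop
  exact this.measurable

theorem measurable_block (m : ℕ) : Measurable (block : SymMat (m + 1) → SymMat m) := by
  have : Continuous (block : SymMat (m + 1) → SymMat m) :=
    Continuous.subtype_mk (continuous_subtype_val.matrix_submatrix _ _) _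
  exact this.measurable

/-- The average of `g` over the `SO(n)`-orbit of `X`. -/
noncomputable def orbitAverage {n : ℕ} (g : SymMat n → ENNReal) (X : SymMat n) : ENNReal :=
  ∫⁻ k, g (act k X) ∂haarSO n

theorem measurable_orbitAverage {n : ℕ} {g : SymMat n → ENNReal} (hg : Measurable g) :
    Measurable (orbitAverage g) :=
  (hg.comp (measurable_act n)).lintegral_prod_left'

theorem orbitAverage_act {n : ℕ} (g : SymMat n → ENNReal) (l : SO n) (X : SymMat n) :
    orbitAverage g (act l X) = orbitAverage g X := by
  simp only [orbitAverage, ← act_mul]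
  exact lintegral_mul_right_eq_self (fun k => g (act k X)) l

/-- The inclusion of `SO(m)` into `SO(m + 1)` as the group fixing the last basis vector. -/
def extend {m : ℕ} (k : SO m) : SO (m + 1) :=
  ⟨(Matrix.fromBlocks (k : Matrix (Fin m) (Fin m) ℝ) 0 0 (1 : Matrix (Fin 1) (Fin 1) ℝ)).submatrix
      finSumFinEquiv.symm finSumFinEquiv.symm, by
    obtain ⟨h1, h2⟩ := Matrix.mem_specialOrthogonalGroup_iff.1 k.2
    refine Matrix.mem_specialOrthogonalGroup_iff.2
      ⟨(Matrix.mem_orthogonalGroup_iff _ _).2 ?_, ?_⟩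
    · rw [Matrix.transpose_submatrix, Matrix.submatrix_mul_equiv,
        Matrix.fromBlocks_transpose, Matrix.fromBlocks_multiply]
      simp [(Matrix.mem_orthogonalGroup_iff _ _).1 h1]
    · rw [Matrix.det_submatrix_equiv_self]
      simpa using h2⟩

theorem block_act_extend {m : ℕ} (k : SO m) (X : SymMat (m + 1)) :
    block (act (extend k) X) = act k (block X) := by
  apply Subtype.ext
  obtain ⟨X, hX⟩ := X
  ext i j
  simp [block, act, extend, SO.coe_inv, Matrix.mul_apply, Fin.sum_univ_castSucc]

theorem lintegral_orbitAverage_block {m : ℕ} {g : SymMat m → ENNReal} (hg : Measurable g)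
    (X : SymMat (m + 1)) :
    ∫⁻ k, orbitAverage g (block (act k X)) ∂haarSO (m + 1) =
      ∫⁻ k, g (block (act k X)) ∂haarSO (m + 1) := by
  have hmeas : Measurable fun p : SO (m + 1) × SO m => g (act p.2 (block (act p.1 X))) := by
    have h1 : Measurable fun k : SO (m + 1) => block (act k X) :=
      (measurable_block m).comp (measurable_act_left X)
    have h2 : Measurable fun p : SO (m + 1) × SO m => (p.2, block (act p.1 X)) :=
      measurable_snd.prodMk (h1.comp measurable_fst)
    have h3 : Measurable fun p : SO m × SymMat m => g (act p.1 p.2) := hg.comp (measurable_act m)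
    have h4 := Measurable.comp (g := fun p : SO m × SymMat m => g (act p.1 p.2)) h3 h2
    simp only [Function.comp_def] at h4
    exact h4
  have hswap := lintegral_lintegral_swap (μ := haarSO (m + 1)) (ν := haarSO m)
    (f := fun k l => g (act l (block (act k X)))) hmeas.aemeasurable
  refine hswap.trans ?_
  have (l : SO m) : ∫⁻ k, g (act l (block (act k X))) ∂haarSO (m + 1) =
      ∫⁻ k, g (block (act k X)) ∂haarSO (m + 1) := by
    simp only [← block_act_extend, ← act_mul]
    exact lintegral_mul_left_eq_self (fun k => g (block (act k X))) (extend l)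
  simp [this]

/-! ### The last row of a random rotation -/

theorem SO.coe_mul_transpose {n : ℕ} (k : SO n) :
    (k : Matrix (Fin n) (Fin n) ℝ) * (k : Matrix (Fin n) (Fin n) ℝ).transpose = 1 :=
  (Matrix.mem_orthogonalGroup_iff (Fin n) ℝ).1 (Matrix.mem_specialOrthogonalGroup_iff.1 k.2).1

theorem SO.det_coe {n : ℕ} (k : SO n) : (k : Matrix (Fin n) (Fin n) ℝ).det = 1 :=
  (Matrix.mem_specialOrthogonalGroup_iff.1 k.2).2

/-- Changing the sign of one row makes an orthogonal matrix special orthogonal. -/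
theorem exists_SO_of_row_sign {n : ℕ} (i₀ : Fin n) {A : Matrix (Fin n) (Fin n) ℝ}
    (hA : A * A.transpose = 1) :
    ∃ (k : SO n) (d : Fin n → ℝ), (∀ i, d i * d i = 1) ∧ (∀ i, i ≠ i₀ → d i = 1) ∧
      (k : Matrix (Fin n) (Fin n) ℝ) = Matrix.diagonal d * A := by
  have hdet : A.det * A.det = 1 := by
    have := congrArg Matrix.det hA
    simpa using this
  set d : Fin n → ℝ := Function.update 1 i₀ A.det with hd
  have hd1 : ∀ i, d i * d i = 1 := by
    intro i
    by_cases h : i = i₀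
    · subst h; simp [hd, hdet]
    · simp [hd, h]
  refine ⟨⟨Matrix.diagonal d * A, Matrix.mem_specialOrthogonalGroup_iff.2
    ⟨(Matrix.mem_orthogonalGroup_iff _ _).2 ?_, ?_⟩⟩, d, hd1, fun i hi => by simp [hd, hi], rfl⟩
  · have : Matrix.diagonal d * A * (Matrix.diagonal d * A).transpose =
        Matrix.diagonal d * (A * A.transpose) * Matrix.diagonal d := by
      simp [Matrix.transpose_mul, Matrix.mul_assoc]
    rw [this, hA]
    simp [hd1]
  · rw [Matrix.det_mul, Matrix.det_diagonal, hd, Finset.prod_update_of_mem (Finset.mem_univ _)]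
    simp [hdet]

/-- Every unit vector is the last row of some element of `SO(m + 1)`, for `m ≥ 1`. -/
theorem exists_SO_last_row {m : ℕ} (hm : 1 ≤ m) {x : Fin (m + 1) → ℝ} (hx : ∑ i, x i ^ 2 = 1) :
    ∃ k : SO (m + 1), (k : Matrix (Fin (m + 1)) (Fin (m + 1)) ℝ) (Fin.last m) = x := by
  set v : Fin (m + 1) → EuclideanSpace ℝ (Fin (m + 1)) := fun _ => WithLp.toLp 2 x with hv
  have hnorm : ‖(WithLp.toLp 2 x : EuclideanSpace ℝ (Fin (m + 1)))‖ = 1 := by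
    rw [EuclideanSpace.norm_eq]
    simp [hx]
  have hon : Orthonormal ℝ (Set.domRestrict {Fin.last m} v) := by
    refine ⟨fun i => hnorm, fun i j hij => (hij (Subsingleton.elim _ _)).elim⟩
  obtain ⟨b, hb⟩ := hon.exists_orthonormalBasis_extension_of_card_eq (by simp)
  set A : Matrix (Fin (m + 1)) (Fin (m + 1)) ℝ := Matrix.of fun i j => b i j with hAdef
  have hA : A * A.transpose = 1 := by
    ext i j
    have := orthonormal_iff_ite.1 b.orthonormal j i
    rw [PiLp.inner_apply] at this
    simpa [Matrix.mul_apply, hAdef, Matrix.one_apply, eq_comm] using this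
  -- The sign of the first row is corrected, which is not the last one since `m ≥ 1`.
  have h0 : Fin.last m ≠ 0 := by
    rw [Ne, Fin.ext_iff, Fin.val_last, Fin.val_zero]
    omega
  obtain ⟨k, d, -, hd, hk⟩ := exists_SO_of_row_sign (0 : Fin (m + 1)) hA
  refine ⟨k, ?_⟩
  ext j
  rw [hk, Matrix.diagonal_mul, hd _ h0]
  simp [hAdef, hb (Fin.last m) rfl, hv]

theorem lintegral_vecMul_SO {n : ℕ} (k : SO n) {H : (Fin n → ℝ) → ENNReal} (hH : Measurable H) :
    ∫⁻ x, H (Matrix.vecMul x (k : Matrix (Fin n) (Fin n) ℝ)) = ∫⁻ x, H x := by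
  have h := Real.map_matrix_volume_pi_eq_smul_volume_pi
    (M := (k : Matrix (Fin n) (Fin n) ℝ).transpose) (by simp [SO.det_coe])
  rw [Matrix.det_transpose, SO.det_coe] at h
  simp only [inv_one, abs_one, ENNReal.ofReal_one, one_smul] at h
  conv_rhs => rw [← h]
  rw [lintegral_map hH (by fun_prop)]
  simp [Matrix.mulVec_transpose]

theorem sum_sq_vecMul_SO {n : ℕ} (k : SO n) (x : Fin n → ℝ) :
    ∑ i, (Matrix.vecMul x (k : Matrix (Fin n) (Fin n) ℝ)) i ^ 2 = ∑ i, x i ^ 2 := by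
  have h : ∀ y : Fin n → ℝ, ∑ i, y i ^ 2 = y ⬝ᵥ y := fun y => by simp [dotProduct, sq]
  rw [h, h]
  conv_lhs => rw [← Matrix.mulVec_transpose, Matrix.mulVec_transpose,
    ← Matrix.dotProduct_mulVec, ← Matrix.vecMul_transpose, Matrix.vecMul_vecMul,
    SO.coe_mul_transpose, Matrix.vecMul_one]

/-- The closed Euclidean unit ball of `ℝⁿ`, as a subset of the function space `Fin n → ℝ`. -/
def unitBall (n : ℕ) : Set (Fin n → ℝ) := {x | ∑ i, x i ^ 2 ≤ 1}

theorem measurableSet_unitBall (n : ℕ) : MeasurableSet (unitBall n) :=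
  measurableSet_le (by fun_prop) measurable_const

theorem volume_unitBall_ne_top (n : ℕ) : volume (unitBall n) ≠ ⊤ := by
  refine ne_top_of_le_ne_top (b := volume (Set.Icc (fun _ : Fin n => (-1 : ℝ)) fun _ => 1))
    isCompact_Icc.measure_lt_top.ne (measure_mono fun x hx => ?_)
  have h (i : Fin n) : x i ^ 2 ≤ 1 :=
    (Finset.single_le_sum (f := fun i => x i ^ 2) (fun _ _ => sq_nonneg _)
      (Finset.mem_univ i)).trans hx
  exact ⟨fun i => (abs_le.1 ((sq_le_one_iff_abs_le_one _).1 (h i))).1,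
    fun i => (abs_le.1 ((sq_le_one_iff_abs_le_one _).1 (h i))).2⟩

theorem volume_unitBall_ne_zero (n : ℕ) : volume (unitBall n) ≠ 0 := by
  have ho : IsOpen {x : Fin n → ℝ | ∑ i, x i ^ 2 < 1} := isOpen_lt (by fun_prop) continuous_const
  refine (ho.measure_pos volume ⟨0, by simp⟩).ne' ∘ fun h => measure_mono_null (fun x hx => ?_) h
  exact le_of_lt (Set.mem_ofPred.1 hx)

theorem continuous_SO_row {n : ℕ} (i : Fin n) :
    Continuous fun k : SO n => (k : Matrix (Fin n) (Fin n) ℝ) i :=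
  (continuous_apply i).comp continuous_subtype_val

/-- The last row of a Haar distributed element of `SO(m + 1)` is uniform on the sphere: for a
function that is homogeneous of degree zero, its mean is the mean over the unit ball. -/
theorem setLIntegral_unitBall_eq {m : ℕ} (hm : 1 ≤ m) {G : (Fin (m + 1) → ℝ) → ENNReal}
    (hG : Measurable G) (hhom : ∀ t : ℝ, 0 < t → ∀ x, G (t • x) = G x) :
    ∫⁻ x in unitBall (m + 1), G x = volume (unitBall (m + 1)) *
      ∫⁻ k : SO (m + 1), G ((k : Matrix (Fin (m + 1)) (Fin (m + 1)) ℝ) (Fin.last m))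
        ∂haarSO (m + 1) := by
  set I := ∫⁻ k : SO (m + 1), G ((k : Matrix (Fin (m + 1)) (Fin (m + 1)) ℝ) (Fin.last m))
        ∂haarSO (m + 1)
  have h1 (k : SO (m + 1)) : ∫⁻ x in unitBall (m + 1), G x = ∫⁻ x in unitBall (m + 1),
      G (Matrix.vecMul x (k : Matrix (Fin (m + 1)) (Fin (m + 1)) ℝ)) := by
    rw [← lintegral_indicator (measurableSet_unitBall _),
      ← lintegral_indicator (measurableSet_unitBall _),
      ← lintegral_vecMul_SO k (hG.indicator (measurableSet_unitBall _))]
    refine lintegral_congr fun x => ?_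
    simp only [Set.indicator, unitBall, Set.mem_ofPred_eq, sum_sq_vecMul_SO]
    congr
  have hmeas : Measurable fun p : SO (m + 1) × (Fin (m + 1) → ℝ) =>
      G (Matrix.vecMul p.2 (p.1 : Matrix (Fin (m + 1)) (Fin (m + 1)) ℝ)) := by
    refine hG.comp (Continuous.measurable ?_)
    exact Continuous.matrix_vecMul continuous_snd (continuous_subtype_val.comp continuous_fst)
  calc ∫⁻ x in unitBall (m + 1), G x
      = ∫⁻ k : SO (m + 1), (∫⁻ x in unitBall (m + 1),
          G (Matrix.vecMul x (k : Matrix (Fin (m + 1)) (Fin (m + 1)) ℝ))) ∂haarSO (m + 1) := by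
        simp [← h1]
    _ = ∫⁻ x in unitBall (m + 1), (∫⁻ k : SO (m + 1),
          G (Matrix.vecMul x (k : Matrix (Fin (m + 1)) (Fin (m + 1)) ℝ)) ∂haarSO (m + 1)) :=
        lintegral_lintegral_swap hmeas.aemeasurable
    _ = ∫⁻ x in unitBall (m + 1), I := by
        refine lintegral_congr_ae (ae_restrict_of_ae ?_)
        filter_upwards [Measure.ae_ne volume (0 : Fin (m + 1) → ℝ)] with x hx
        have hpos : 0 < ∑ i, x i ^ 2 := by
          obtain ⟨i, hi⟩ := Function.ne_iff.1 hx
          exact Finset.sum_pos' (fun _ _ => sq_nonneg _)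
            ⟨i, Finset.mem_univ _, sq_pos_of_ne_zero hi⟩
        -- `x` is `|x|` times the last row of some rotation `l`, which the Haar measure absorbs.
        set r := Real.sqrt (∑ i, x i ^ 2) with hr
        have hr0 : 0 < r := Real.sqrt_pos.2 hpos
        obtain ⟨l, hl⟩ := exists_SO_last_row hm (x := r⁻¹ • x) (by
          simp only [Pi.smul_apply, smul_eq_mul, mul_pow, ← Finset.mul_sum]
          rw [inv_pow, hr, Real.sq_sqrt hpos.le, inv_mul_cancel₀ hpos.ne'])
        refine Eq.trans ?_ (lintegral_mul_left_eq_self (fun k : SO (m + 1) =>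
          G ((k : Matrix (Fin (m + 1)) (Fin (m + 1)) ℝ) (Fin.last m))) l)
        refine lintegral_congr fun k => ?_
        rw [← hhom r⁻¹ (by positivity), ← Matrix.smul_vecMul, ← hl]
        rfl
    _ = _ := by rw [setLIntegral_const, mul_comm]

/-! ### The characteristic polynomial of the corner -/

theorem SO.transpose_mul_coe {n : ℕ} (k : SO n) :
    (k : Matrix (Fin n) (Fin n) ℝ).transpose * (k : Matrix (Fin n) (Fin n) ℝ) = 1 :=
  mul_eq_one_comm.1 (SO.coe_mul_transpose k)

theorem SO.adjugate_coe {n : ℕ} (k : SO n) :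
    (k : Matrix (Fin n) (Fin n) ℝ).adjugate = (k : Matrix (Fin n) (Fin n) ℝ).transpose := by
  have h := Matrix.mul_adjugate (k : Matrix (Fin n) (Fin n) ℝ)
  rw [SO.det_coe, one_smul] at h
  calc _ = (k : Matrix (Fin n) (Fin n) ℝ).transpose * k *
          (k : Matrix (Fin n) (Fin n) ℝ).adjugate := by
        rw [SO.transpose_mul_coe, one_mul]
    _ = _ := by rw [mul_assoc, h, mul_one]

/-- The characteristic polynomial of the corner of `k.lam`, at the node `lam i`. The matrix
`lam i - k.lam` is singular, and its adjugate is a multiple of `v vᵀ` for the column `v` of `k` with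
index `i`. -/
theorem eval_charpoly_block {m : ℕ} (k : SO (m + 1)) (lam : Fin (m + 1) → ℝ) (i : Fin (m + 1)) :
    (block (act k (diag lam))).1.charpoly.eval (lam i) =
      (k : Matrix (Fin (m + 1)) (Fin (m + 1)) ℝ) (Fin.last m) i ^ 2 *
        ∏ j : Fin m, (lam i - lam (i.succAbove j)) := by
  set K := (k : Matrix (Fin (m + 1)) (Fin (m + 1)) ℝ)
  set d : Fin (m + 1) → ℝ := fun j => lam i - lam j with hd
  -- The wanted value is the last diagonal entry of the adjugate of `lam i - k.lam`.
  set A := K * Matrix.diagonal d * K.transpose with hA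
  have hA' : A = Matrix.scalar _ (lam i) - (act k (diag lam)).1 := by
    have : Matrix.diagonal d = Matrix.scalar _ (lam i) - Matrix.diagonal lam := by
      ext a b
      by_cases h : a = b <;> simp [Matrix.diagonal, h, hd, Matrix.scalar]
    rw [hA, this, mul_sub, sub_mul,
      ← (Matrix.scalar_commute (lam i) (fun r => mul_comm _ _) K).eq, mul_assoc,
      SO.coe_mul_transpose, mul_one]
    rfl
  have hsub : Matrix.scalar _ (lam i) - (block (act k (diag lam))).1 =
      A.submatrix (Fin.last m).succAbove (Fin.last m).succAbove := by
    rw [hA']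
    ext a b
    simp [block, Matrix.scalar, Matrix.diagonal_apply]
  have hadj : A.adjugate =
      K * Matrix.diagonal (fun j => ∏ l ∈ Finset.univ.erase j, d l) * K.transpose := by
    rw [hA, Matrix.adjugate_mul_distrib, Matrix.adjugate_mul_distrib, ← Matrix.adjugate_transpose,
      SO.adjugate_coe, Matrix.adjugate_diagonal, Matrix.transpose_transpose, mul_assoc]
  have hentry := Matrix.adjugate_fin_succ_eq_det_submatrix A (Fin.last m) (Fin.last m)
  rw [Matrix.eval_charpoly, hsub]
  have hsign : ((-1 : ℝ)) ^ ((Fin.last m : ℕ) + (Fin.last m : ℕ)) = 1 := Even.neg_one_pow ⟨_, rfl⟩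
  rw [hsign, one_mul] at hentry
  rw [← hentry, hadj, Matrix.mul_apply]
  simp only [Matrix.mul_diagonal, Matrix.transpose_apply]
  -- Since `d i = 0`, only the `i`-th diagonal entry of `adjugate (diagonal d)` survives.
  rw [Finset.sum_eq_single i]
  · have : ∏ l ∈ Finset.univ.erase i, d l = ∏ j : Fin m, (lam i - lam (i.succAbove j)) := by
      rw [← Finset.compl_singleton, ← Fin.image_succAbove_univ, Finset.prod_image
        (fun a _ b _ h => Fin.succAbove_right_injective h)]
    rw [this]; ring
  · intro j _ hj
    rw [Finset.prod_eq_zero (i := i) (by simp [hj.symm]) (by simp [hd])]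
    simp
  · simp

/-- A symmetric matrix whose characteristic polynomial is `∏ (X - μ j)` lies in the `SO(m)`-orbit
of `diag μ`. -/
theorem exists_act_diag_of_charpoly_eq {m : ℕ} (hm : 1 ≤ m) (X : SymMat m) {μ : Fin m → ℝ}
    (hμ : Function.Injective μ) (h : X.1.charpoly = ∏ j, (Polynomial.X - Polynomial.C (μ j))) :
    ∃ k : SO m, X = act k (diag μ) := by
  have hH : X.1.IsHermitian := by
    rw [Matrix.IsHermitian, Matrix.conjTranspose_eq_transpose_of_trivial]; exact X.2
  obtain ⟨σ, hσ⟩ : ∃ σ : Equiv.Perm (Fin m), ∀ j, hH.eigenvalues (σ j) = μ j := by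
    have hex (j : Fin m) : ∃ i, hH.eigenvalues i = μ j := by
      have h1 := hH.charpoly_eq
      rw [h] at h1
      have h2 := congrArg (Polynomial.eval (μ j)) h1
      rw [Polynomial.eval_prod, Polynomial.eval_prod,
        Finset.prod_eq_zero (Finset.mem_univ j) (by simp)] at h2
      obtain ⟨i, -, hi⟩ := Finset.prod_eq_zero_iff.1 h2.symm
      refine ⟨i, ?_⟩
      simp only [Polynomial.eval_sub, Polynomial.eval_X, Polynomial.eval_C, sub_eq_zero] at hi
      exact hi.symm
    choose σ hσ using hex
    have hinj : Function.Injective σ := fun a b hab => hμ (by rw [← hσ a, ← hσ b, hab])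
    exact ⟨Equiv.ofBijective σ (Finite.injective_iff_bijective.1 hinj), hσ⟩
  set U : Matrix (Fin m) (Fin m) ℝ := (hH.eigenvectorUnitary : Matrix (Fin m) (Fin m) ℝ) with hU
  have hUU : U * U.transpose = 1 := by
    have := (Matrix.mem_unitaryGroup_iff).1 hH.eigenvectorUnitary.2
    rwa [Matrix.star_eq_conjTranspose, Matrix.conjTranspose_eq_transpose_of_trivial] at this
  have hspec : X.1 = U * Matrix.diagonal hH.eigenvalues * U.transpose := by
    have := hH.spectral_theorem
    rw [Unitary.conjStarAlgAut_apply, Matrix.star_eq_conjTranspose,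
      Matrix.conjTranspose_eq_transpose_of_trivial] at this
    exact this
  -- The rows of `A` are the eigenvectors, in the order of `μ`.
  set A := (U.submatrix id σ).transpose with hA
  have hAA : A * A.transpose = 1 := by
    rw [hA, Matrix.transpose_transpose, Matrix.transpose_submatrix,
      ← Matrix.submatrix_mul _ _ σ id σ Function.bijective_id, mul_eq_one_comm.1 hUU]
    exact Matrix.submatrix_one_equiv σ
  have hX : X.1 = A.transpose * Matrix.diagonal μ * A := by
    have h1 : Matrix.diagonal μ = (Matrix.diagonal hH.eigenvalues).submatrix σ σ := by
      rw [Matrix.submatrix_diagonal_equiv]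
      congr 1; ext j; exact (hσ j).symm
    rw [hspec, hA, h1, Matrix.transpose_transpose, Matrix.transpose_submatrix,
      Matrix.submatrix_mul_equiv, Matrix.submatrix_mul_equiv, Matrix.submatrix_id_id]
  obtain ⟨k, d, hd, -, hk⟩ := exists_SO_of_row_sign (⟨0, hm⟩ : Fin m) hAA
  refine ⟨k⁻¹, Subtype.ext ?_⟩
  rw [hX]
  simp only [act, inv_inv, SO.coe_inv, diag, hk, Matrix.transpose_mul, Matrix.diagonal_transpose]
  have : Matrix.diagonal d * Matrix.diagonal μ * Matrix.diagonal d = Matrix.diagonal μ := by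
    simp only [Matrix.diagonal_mul_diagonal]
    congr 1; ext i; rw [mul_right_comm, hd, one_mul]
  simp only [mul_assoc] at this ⊢
  rw [← mul_assoc (Matrix.diagonal μ), ← mul_assoc (Matrix.diagonal d), this]

/-! ### Residues of rational functions with interlacing zeros and poles -/

open Polynomial

variable {m : ℕ}

/-- The derivative `∏_{j ≠ i} (lam i - lam j)` at the node `lam i` of the monic polynomial with
roots `lam`. The indices `j ≠ i` are enumerated by `i.succAbove`. -/
def nodeDeriv (lam : Fin (m + 1) → ℝ) (i : Fin (m + 1)) : ℝ :=
  ∏ j : Fin m, (lam i - lam (i.succAbove j))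

theorem nodeDeriv_ne_zero {lam : Fin (m + 1) → ℝ} (hlam : StrictMono lam) (i : Fin (m + 1)) :
    nodeDeriv lam i ≠ 0 :=
  Finset.prod_ne_zero_iff.2 fun j _ =>
    sub_ne_zero.2 fun h => Fin.succAbove_ne i j (hlam.injective h).symm

/-- The polynomial with leading coefficient `z 0` and roots `z 1, …, z m`. -/
noncomputable def rootPoly (z : Fin (m + 1) → ℝ) : ℝ[X] :=
  C (z 0) * ∏ j : Fin m, (X - C (z j.succ))

theorem eval_rootPoly (z : Fin (m + 1) → ℝ) (x : ℝ) :
    (rootPoly z).eval x = z 0 * ∏ j : Fin m, (x - z j.succ) := by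
  simp [rootPoly, eval_prod]

theorem natDegree_rootPoly_le (z : Fin (m + 1) → ℝ) : (rootPoly z).natDegree ≤ m := by
  refine (natDegree_C_mul_le _ _).trans (le_of_eq ?_)
  rw [natDegree_prod_of_monic _ _ fun j _ => monic_X_sub_C _]
  simp

theorem coeff_rootPoly (z : Fin (m + 1) → ℝ) : (rootPoly z).coeff m = z 0 := by
  have hmon : (∏ j : Fin m, (X - C (z j.succ))).Monic :=
    monic_prod_of_monic _ _ fun j _ => monic_X_sub_C _
  have hdeg : (∏ j : Fin m, (X - C (z j.succ))).natDegree = m := by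
    rw [natDegree_prod_of_monic _ _ fun j _ => monic_X_sub_C _]
    simp
  have := hmon.coeff_natDegree
  rw [hdeg] at this
  rw [rootPoly, coeff_C_mul, this, mul_one]

theorem eq_of_eval_nodes_eq {lam : Fin (m + 1) → ℝ} (hlam : Function.Injective lam) {p q : ℝ[X]}
    (hp : p.natDegree ≤ m) (hq : q.natDegree ≤ m) (h : ∀ i, p.eval (lam i) = q.eval (lam i)) :
    p = q := by
  have hdeg {r : ℝ[X]} (hr : r.natDegree ≤ m) :
      r.degree < ((Finset.univ : Finset (Fin (m + 1))).card : WithBot ℕ) := by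
    refine degree_le_natDegree.trans_lt ?_
    rw [Finset.card_fin]
    exact_mod_cast Nat.lt_succ_of_le hr
  exact eq_of_degrees_lt_of_eval_index_eq Finset.univ hlam.injOn (hdeg hp) (hdeg hq) fun i _ => h i

/-- The map `(s, μ) ↦ (s ∏ⱼ (lam i - μ j) / ∏_{j ≠ i} (lam i - lam j))ᵢ`, where `z = (s, μ)`: the
residues at the nodes of the rational function `s ∏ⱼ (x - μ j) / ∏ᵢ (x - lam i)`. -/
noncomputable def residueMap (lam z : Fin (m + 1) → ℝ) (i : Fin (m + 1)) : ℝ :=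
  (rootPoly z).eval (lam i) / nodeDeriv lam i

/-- The set of `z = (s, μ)` with `s > 0` and `μ` interlacing `lam`. -/
def residueDomain (lam : Fin (m + 1) → ℝ) : Set (Fin (m + 1) → ℝ) :=
  {z | 0 < z 0 ∧ (fun j : Fin m => z j.succ) ∈ interlacing lam}

theorem prod_div_nodeDeriv_pos {lam : Fin (m + 1) → ℝ} (hlam : StrictMono lam) {μ : Fin m → ℝ}
    (hμ : μ ∈ interlacing lam) (i : Fin (m + 1)) :
    0 < (∏ j, (lam i - μ j)) / nodeDeriv lam i := by
  rw [nodeDeriv, ← Finset.prod_div_distrib]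
  refine Finset.prod_pos fun j _ => ?_
  -- The `j`-th node other than `lam i` is an end of the gap of `μ j` on the same side of `lam i`.
  obtain ⟨h1, h2⟩ := hμ j
  rcases lt_or_ge j.castSucc i with h | h
  · rw [Fin.succAbove_of_castSucc_lt _ _ h]
    have h3 : lam j.succ ≤ lam i := hlam.monotone (Fin.castSucc_lt_iff_succ_le.1 h)
    exact div_pos (by linarith) (by linarith)
  · rw [Fin.succAbove_of_le_castSucc _ _ h]
    have h3 : lam i ≤ lam j.castSucc := hlam.monotone h
    exact div_pos_of_neg_of_neg (by linarith) (by linarith)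

theorem residueMap_pos {lam : Fin (m + 1) → ℝ} (hlam : StrictMono lam) {z : Fin (m + 1) → ℝ}
    (hz : z ∈ residueDomain lam) (i : Fin (m + 1)) : 0 < residueMap lam z i := by
  rw [residueMap, eval_rootPoly, mul_div_assoc]
  exact mul_pos hz.1 (prod_div_nodeDeriv_pos hlam hz.2 i)

theorem rootPoly_eq_of_residueMap_eq {lam : Fin (m + 1) → ℝ} (hlam : StrictMono lam)
    {z : Fin (m + 1) → ℝ} {p : ℝ[X]} (hp : p.natDegree ≤ m)
    (h : ∀ i, p.eval (lam i) = residueMap lam z i * nodeDeriv lam i) : p = rootPoly z := by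
  refine eq_of_eval_nodes_eq hlam.injective hp (natDegree_rootPoly_le z) fun i => ?_
  rw [h, residueMap, div_mul_cancel₀ _ (nodeDeriv_ne_zero hlam i)]

/-- The gap between `lam j` and `lam (j + 1)` contains no point of an interlacing `μ` but `μ j`. -/
theorem interlacing_eq_of_mem_gap {lam : Fin (m + 1) → ℝ} (hlam : StrictMono lam) {μ : Fin m → ℝ}
    (hμ : μ ∈ interlacing lam) {j l : Fin m} {x : ℝ} (hx : lam j.castSucc < x ∧ x < lam j.succ)
    (h : x = μ l) : j = l := by
  subst h
  obtain ⟨h1, h2⟩ := hμ l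
  have h3 := hlam.lt_iff_lt.1 (hx.1.trans h2)
  have h4 := hlam.lt_iff_lt.1 (h1.trans hx.2)
  rw [Fin.castSucc_lt_succ_iff] at h3 h4
  exact le_antisymm h3 h4

theorem residueMap_injOn {lam : Fin (m + 1) → ℝ} (hlam : StrictMono lam) :
    Set.InjOn (residueMap lam) (residueDomain lam) := by
  intro z hz w hw h
  have hP : rootPoly z = rootPoly w :=
    rootPoly_eq_of_residueMap_eq hlam (natDegree_rootPoly_le z) fun i => by
      rw [← h, residueMap, div_mul_cancel₀ _ (nodeDeriv_ne_zero hlam i)]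
  ext i
  induction i using Fin.cases with
  | zero => rw [← coeff_rootPoly z, hP, coeff_rootPoly w]
  | succ j =>
    have h0 : (rootPoly w).eval (z j.succ) = 0 := by
      rw [← hP, eval_rootPoly, Finset.prod_eq_zero (Finset.mem_univ j) (sub_self _), mul_zero]
    rw [eval_rootPoly, mul_eq_zero, or_iff_right hw.1.ne', Finset.prod_eq_zero_iff] at h0
    obtain ⟨l, -, hl⟩ := h0
    have := interlacing_eq_of_mem_gap hlam hw.2 (hz.2 j) (sub_eq_zero.1 hl)
    rw [sub_eq_zero.1 hl, this]

/-- The derivative changes sign between consecutive nodes: in the product of the two derivatives the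
factors pair up, and only the pair formed by the two nodes themselves is negative. -/
theorem nodeDeriv_mul_nodeDeriv_neg {lam : Fin (m + 1) → ℝ} (hlam : StrictMono lam) (j : Fin m) :
    nodeDeriv lam j.castSucc * nodeDeriv lam j.succ < 0 := by
  rw [nodeDeriv, nodeDeriv, ← Finset.prod_mul_distrib,
    ← Finset.mul_prod_erase _ _ (Finset.mem_univ j)]
  refine mul_neg_of_neg_of_pos ?_ (Finset.prod_pos fun l hl => ?_)
  · have := hlam (Fin.castSucc_lt_succ (i := j))
    rw [Fin.succAbove_castSucc_self, Fin.succAbove_succ_self]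
    nlinarith
  · rcases lt_or_gt_of_ne (Finset.ne_of_mem_erase hl) with h | h
    · rw [Fin.succAbove_of_castSucc_lt _ _ (Fin.castSucc_lt_castSucc_iff.2 h),
        Fin.succAbove_of_castSucc_lt _ _
          ((Fin.castSucc_lt_castSucc_iff.2 h).trans Fin.castSucc_lt_succ)]
      have h1 := hlam (Fin.castSucc_lt_castSucc_iff.2 h)
      have h2 := hlam (Fin.castSucc_lt_succ (i := j))
      exact mul_pos (by linarith) (by linarith)
    · rw [Fin.succAbove_of_le_castSucc _ _ (Fin.castSucc_lt_castSucc_iff.2 h).le,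
        Fin.succAbove_of_le_castSucc _ _
          (Fin.castSucc_lt_iff_succ_le.1 (Fin.castSucc_lt_castSucc_iff.2 h))]
      have h1 := hlam (Fin.succ_lt_succ_iff.2 h)
      have h2 := hlam (Fin.castSucc_lt_succ (i := j))
      exact mul_pos_of_neg_of_neg (by linarith) (by linarith)

/-- Every positive vector is a vector of residues: the interpolation polynomial changes sign in
each gap between consecutive nodes. -/
theorem residueMap_surjOn {lam : Fin (m + 1) → ℝ} (hlam : StrictMono lam) {y : Fin (m + 1) → ℝ}
    (hy : ∀ i, 0 < y i) : ∃ z ∈ residueDomain lam, residueMap lam z = y := by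
  have hinj : Set.InjOn lam (Finset.univ : Finset (Fin (m + 1))) := hlam.injective.injOn
  set p := Lagrange.interpolate Finset.univ lam fun i => y i * nodeDeriv lam i with hp
  have hpe (i) : p.eval (lam i) = y i * nodeDeriv lam i :=
    Lagrange.eval_interpolate_at_node _ hinj (Finset.mem_univ i)
  have hpd : p.natDegree ≤ m := by
    have := Lagrange.degree_interpolate_le (fun i => y i * nodeDeriv lam i) hinj
    rw [Finset.card_fin, Nat.add_sub_cancel] at this
    exact natDegree_le_of_degree_le this
  have hroot (j : Fin m) : ∃ x, (lam j.castSucc < x ∧ x < lam j.succ) ∧ p.eval x = 0 := by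
    have hlt := hlam (Fin.castSucc_lt_succ (i := j))
    have hneg : p.eval (lam j.castSucc) * p.eval (lam j.succ) < 0 := by
      rw [hpe, hpe, mul_mul_mul_comm]
      exact mul_neg_of_pos_of_neg (mul_pos (hy _) (hy _)) (nodeDeriv_mul_nodeDeriv_neg hlam j)
    have hc : ContinuousOn (fun x => p.eval x) (Set.Icc (lam j.castSucc) (lam j.succ)) :=
      p.continuous.continuousOn
    rcases mul_neg_iff.1 hneg with ⟨h1, h2⟩ | ⟨h1, h2⟩
    · obtain ⟨x, hx, hx0⟩ := intermediate_value_Ioo' hlt.le hc ⟨h2, h1⟩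
      exact ⟨x, hx, hx0⟩
    · obtain ⟨x, hx, hx0⟩ := intermediate_value_Ioo hlt.le hc ⟨h1, h2⟩
      exact ⟨x, hx, hx0⟩
  choose μ hμ hμ0 using hroot
  -- `p` may a priori have degree less than `m`; positivity of its coefficient comes at the end.
  set z : Fin (m + 1) → ℝ := Fin.cons (p.coeff m) μ with hz
  have hpz : p = rootPoly z := by
    have hμinj : Function.Injective μ := fun a b h => interlacing_eq_of_mem_gap hlam hμ (hμ a) h
    refine eq_of_degree_sub_lt_of_eval_index_eq (v := μ) Finset.univ hμinj.injOn ?_ fun j _ => ?_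
    · rw [Finset.card_fin, degree_lt_iff_coeff_zero]
      intro l hl
      rcases hl.eq_or_lt with rfl | hl
      · rw [coeff_sub, coeff_rootPoly]; simp [hz]
      · rw [coeff_sub, coeff_eq_zero_of_natDegree_lt (hpd.trans_lt hl),
          coeff_eq_zero_of_natDegree_lt ((natDegree_rootPoly_le z).trans_lt hl), sub_zero]
    · rw [hμ0, eval_rootPoly, Finset.prod_eq_zero (Finset.mem_univ j) (by simp [hz]), mul_zero]
  have hres : residueMap lam z = y := by
    ext i
    rw [residueMap, ← hpz, hpe, mul_div_cancel_right₀ _ (nodeDeriv_ne_zero hlam i)]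
  have hzμ : (fun j : Fin m => z j.succ) ∈ interlacing lam := fun j => by simpa [hz] using hμ j
  refine ⟨z, ⟨?_, hzμ⟩, hres⟩
  have h0 := hy 0
  rw [← hres, residueMap, eval_rootPoly, mul_div_assoc] at h0
  exact pos_of_mul_pos_left h0 (prod_div_nodeDeriv_pos hlam hzμ 0).le

theorem image_residueMap {lam : Fin (m + 1) → ℝ} (hlam : StrictMono lam) :
    residueMap lam '' residueDomain lam = {y | ∀ i, 0 < y i} := by
  ext y
  constructor
  · rintro ⟨z, hz, rfl⟩
    exact residueMap_pos hlam hz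
  · intro hy
    exact residueMap_surjOn hlam hy

theorem isOpen_residueDomain (lam : Fin (m + 1) → ℝ) : IsOpen (residueDomain lam) := by
  have : residueDomain lam = {z | 0 < z 0} ∩
      ⋂ j : Fin m, {z | lam j.castSucc < z j.succ} ∩ {z | z j.succ < lam j.succ} := by
    ext z; simp [residueDomain, interlacing]
  rw [this]
  refine (isOpen_lt continuous_const (continuous_apply _)).inter
    (isOpen_iInter_of_finite fun j => (isOpen_lt continuous_const (continuous_apply _)).inter
      (isOpen_lt (continuous_apply _) continuous_const))

/-! ### The Jacobian of the residue map -/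

/-- The partial derivatives of `rootPoly` with respect to its parameters `z`. -/
noncomputable def partialPoly (z : Fin (m + 1) → ℝ) : Fin (m + 1) → ℝ[X] :=
  Fin.cons (∏ j : Fin m, (X - C (z j.succ)))
    fun j => C (-z 0) * ∏ l ∈ Finset.univ.erase j, (X - C (z l.succ))

theorem eval_partialPoly_zero (z : Fin (m + 1) → ℝ) (x : ℝ) :
    (partialPoly z 0).eval x = ∏ j : Fin m, (x - z j.succ) := by
  simp [partialPoly, eval_prod]

theorem eval_partialPoly_succ (z : Fin (m + 1) → ℝ) (j : Fin m) (x : ℝ) :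
    (partialPoly z j.succ).eval x = -z 0 * ∏ l ∈ Finset.univ.erase j, (x - z l.succ) := by
  simp [partialPoly, eval_prod]

theorem natDegree_partialPoly_lt (z : Fin (m + 1) → ℝ) (j : Fin (m + 1)) :
    (partialPoly z j).natDegree < m + 1 := by
  have h (s : Finset (Fin m)) : (∏ l ∈ s, (X - C (z l.succ))).natDegree < m + 1 := by
    rw [natDegree_prod_of_monic _ _ fun j _ => monic_X_sub_C _]
    simpa using Nat.lt_succ_of_le (s.card_le_univ.trans_eq (Fintype.card_fin m))
  induction j using Fin.cases with
  | zero => exact h Finset.univ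
  | succ j => exact (natDegree_C_mul_le _ _).trans_lt (h _)

/-- The absolute value `∏_{i < j} |v i - v j|` of the Vandermonde determinant. -/
def absVandermonde {n : ℕ} (v : Fin n → ℝ) : ℝ := ∏ i : Fin n, ∏ j ∈ Finset.Ioi i, |v i - v j|

theorem abs_det_vandermonde {n : ℕ} (v : Fin n → ℝ) :
    |(Matrix.vandermonde v).det| = absVandermonde v := by
  rw [Matrix.det_vandermonde, Finset.abs_prod]
  refine Finset.prod_congr rfl fun i _ => ?_
  rw [Finset.abs_prod]
  exact Finset.prod_congr rfl fun j _ => abs_sub_comm _ _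

theorem absVandermonde_pos {n : ℕ} {v : Fin n → ℝ} (hv : Function.Injective v) :
    0 < absVandermonde v :=
  Finset.prod_pos fun _ _ => Finset.prod_pos fun _ hj =>
    abs_pos.2 (sub_ne_zero.2 fun h => (Finset.mem_Ioi.1 hj).ne (hv h))

theorem absVandermonde_cons {n : ℕ} (t : ℝ) (v : Fin n → ℝ) :
    absVandermonde (Fin.cons t v : Fin (n + 1) → ℝ) = (∏ j, |t - v j|) * absVandermonde v := by
  rw [absVandermonde, absVandermonde, Fin.prod_univ_succ]
  congr 1
  · rw [Fin.Ioi_zero_eq_map, Finset.prod_map]; simp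
  · refine Finset.prod_congr rfl fun i _ => ?_
    rw [Fin.Ioi_succ, Finset.prod_map]; simp

theorem prod_prod_ne_eq_sq {n : ℕ} (v : Fin n → ℝ) :
    ∏ i, ∏ j ∈ Finset.univ.erase i, |v i - v j| = absVandermonde v ^ 2 := by
  have h := Finset.prod_prod_Ioi_mul_eq_prod_prod_off_diag fun i j : Fin n => |v j - v i|
  simp only [← Finset.compl_singleton]
  rw [← h, absVandermonde, sq]
  simp only [← Finset.prod_mul_distrib]
  refine Finset.prod_congr rfl fun i _ => Finset.prod_congr rfl fun j _ => ?_
  rw [abs_sub_comm (v j)]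

/-- Evaluating polynomials of degree less than `n` at `n` points is multiplication of the
coefficient matrix by a Vandermonde matrix. -/
theorem det_eval_eq {n : ℕ} (q : Fin n → ℝ[X]) (hq : ∀ j, (q j).natDegree < n) (v : Fin n → ℝ) :
    (Matrix.of fun i j => (q j).eval (v i)).det =
      (Matrix.vandermonde v).det * (Matrix.of fun i j : Fin n => (q j).coeff i).det := by
  rw [← Matrix.det_mul]
  congr 1
  ext i j
  rw [Matrix.of_apply, eval_eq_sum_range' (hq j), Matrix.mul_apply, Finset.sum_range]
  exact Finset.sum_congr rfl fun l _ => by simp [Matrix.vandermonde_apply, mul_comm]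

/-- The coefficient determinant of `partialPoly`. It is found by evaluating the polynomials at the
roots `z 1, …, z m`, where the evaluation matrix is triangular, and at one auxiliary point. -/
theorem abs_det_coeff_partialPoly {z : Fin (m + 1) → ℝ} (hz : 0 < z 0)
    (hinj : Function.Injective fun j : Fin m => z j.succ) :
    |(Matrix.of fun i j : Fin (m + 1) => (partialPoly z j).coeff i).det| =
      z 0 ^ m * absVandermonde fun j : Fin m => z j.succ := by
  obtain ⟨t, ht⟩ : ∃ t : ℝ, ∀ j : Fin m, t ≠ z j.succ := by
    obtain ⟨t, ht⟩ := Infinite.exists_notMem_finset (Finset.univ.image fun j : Fin m => z j.succ)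
    exact ⟨t, fun j h => ht (Finset.mem_image.2 ⟨j, Finset.mem_univ _, h.symm⟩)⟩
  set μ : Fin m → ℝ := fun j => z j.succ with hμ
  have h1 := congrArg abs (det_eval_eq (partialPoly z) (natDegree_partialPoly_lt z) (Fin.cons t μ))
  rw [abs_mul, abs_det_vandermonde, absVandermonde_cons] at h1
  have h2 : |(Matrix.of fun i j =>
        (partialPoly z j).eval ((Fin.cons t μ : Fin (m + 1) → ℝ) i)).det| =
      (∏ j, |t - μ j|) * (z 0 ^ m * absVandermonde μ ^ 2) := by
    rw [Matrix.det_of_isUpperTriangular, Fin.prod_univ_succ, abs_mul]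
    · congr 1
      · simp [eval_partialPoly_zero, Finset.abs_prod, hμ]
      · rw [Finset.abs_prod, ← prod_prod_ne_eq_sq]
        simp [eval_partialPoly_succ, Finset.abs_prod, abs_mul, abs_of_pos hz,
          Finset.prod_mul_distrib, hμ]
    · intro i j hij
      induction i using Fin.cases with
      | zero => exact absurd hij (by simp)
      | succ i =>
        induction j using Fin.cases with
        | zero =>
          simp only [Matrix.of_apply, Fin.cons_succ, eval_partialPoly_zero]
          exact Finset.prod_eq_zero (Finset.mem_univ i) (sub_self _)
        | succ j =>
          simp only [Matrix.of_apply, Fin.cons_succ, eval_partialPoly_succ]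
          have hij' : j < i := Fin.succ_lt_succ_iff.1 hij
          rw [Finset.prod_eq_zero (Finset.mem_erase.2 ⟨hij'.ne', Finset.mem_univ i⟩) (sub_self _),
            mul_zero]
  rw [h2] at h1
  have h3 : 0 < ∏ j, |t - μ j| := Finset.prod_pos fun j _ => abs_pos.2 (sub_ne_zero.2 (ht j))
  have h4 := absVandermonde_pos hinj
  refine mul_left_cancel₀ (mul_pos h3 h4).ne' (h1.symm.trans ?_)
  ring

/-- The Jacobian matrix of `residueMap`. -/
noncomputable def residueJacobian (lam z : Fin (m + 1) → ℝ) :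
    Matrix (Fin (m + 1)) (Fin (m + 1)) ℝ :=
  Matrix.of fun i j => (nodeDeriv lam i)⁻¹ * (partialPoly z j).eval (lam i)

theorem hasFDerivAt_residueMap (lam z : Fin (m + 1) → ℝ) :
    HasFDerivAt (residueMap lam)
      (Matrix.toLin' (residueJacobian lam z)).toContinuousLinearMap z := by
  rw [hasFDerivAt_pi']
  intro i
  have hp (k : Fin (m + 1)) : HasFDerivAt (fun w : Fin (m + 1) → ℝ => w k)
      (ContinuousLinearMap.proj (R := ℝ) (φ := fun _ => ℝ) k) z := hasFDerivAt_apply k z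
  have h1 := ((hp 0).mul (HasFDerivAt.finsetProd (u := Finset.univ)
    fun (j : Fin m) _ => (hp j.succ).const_sub (lam i))).mul_const (nodeDeriv lam i)⁻¹
  have h2 : (fun w : Fin (m + 1) → ℝ => residueMap lam w i) = fun w =>
      (w 0 * ∏ j : Fin m, (lam i - w j.succ)) * (nodeDeriv lam i)⁻¹ := by
    ext w; rw [residueMap, eval_rootPoly, div_eq_mul_inv]
  rw [h2]
  refine h1.congr_fderiv (ContinuousLinearMap.ext fun v => ?_)
  simp [Matrix.mulVec, dotProduct, Fin.sum_univ_succ, residueJacobian, eval_partialPoly_zero,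
    eval_partialPoly_succ]
  simp only [Finset.mul_sum, mul_assoc]
  exact add_comm _ _

theorem prod_abs_nodeDeriv (lam : Fin (m + 1) → ℝ) :
    ∏ i, |nodeDeriv lam i| = absVandermonde lam ^ 2 := by
  rw [← prod_prod_ne_eq_sq]
  refine Finset.prod_congr rfl fun i _ => ?_
  rw [nodeDeriv, Finset.abs_prod, ← Finset.compl_singleton, ← Fin.image_succAbove_univ,
    Finset.prod_image fun a _ b _ h => Fin.succAbove_right_injective h]

theorem abs_det_residueJacobian {lam : Fin (m + 1) → ℝ} (hlam : StrictMono lam)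
    {z : Fin (m + 1) → ℝ} (hz : 0 < z 0) (hinj : Function.Injective fun j : Fin m => z j.succ) :
    |(residueJacobian lam z).det| =
      z 0 ^ m * absVandermonde (fun j : Fin m => z j.succ) / absVandermonde lam := by
  have hV := absVandermonde_pos hlam.injective
  have h := Matrix.det_mul_column (fun i => (nodeDeriv lam i)⁻¹)
    (Matrix.of fun i j => (partialPoly z j).eval (lam i))
  simp only [Matrix.of_apply] at h
  rw [residueJacobian, h, det_eval_eq _ (natDegree_partialPoly_lt z), abs_mul, abs_mul,
    abs_det_vandermonde, abs_det_coeff_partialPoly hz hinj, Finset.abs_prod]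
  simp only [abs_inv]
  rw [Finset.prod_inv_distrib, prod_abs_nodeDeriv]
  field_simp

/-! ### Squared coordinates -/

/-- The density of the image of Lebesgue measure under `x ↦ x ^ 2`. -/
noncomputable def sqDensity : ℝ → ENNReal :=
  (Set.Ioi 0).indicator fun y => ENNReal.ofReal (√y)⁻¹

theorem measurable_sqDensity : Measurable sqDensity := by
  refine Measurable.indicator ?_ measurableSet_Ioi
  fun_prop

theorem lintegral_comp_sq (g : ℝ → ENNReal) :
    ∫⁻ x, g (x ^ 2) = ∫⁻ y, sqDensity y * g y := by
  have hpos : ∫⁻ x in Set.Ioi (0 : ℝ), g (x ^ 2) =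
      ∫⁻ y in Set.Ioi (0 : ℝ), ENNReal.ofReal ((√y)⁻¹ / 2) * g y := by
    have himg : Real.sqrt '' Set.Ioi 0 = Set.Ioi 0 := by
      ext x
      constructor
      · rintro ⟨y, hy, rfl⟩; exact Real.sqrt_pos.2 hy
      · intro hx; exact ⟨x ^ 2, Set.mem_Ioi.2 (pow_pos (Set.mem_Ioi.1 hx) 2),
          Real.sqrt_sq (le_of_lt hx)⟩
    have h := lintegral_image_eq_lintegral_abs_deriv_mul (s := Set.Ioi 0) (f := Real.sqrt)
      (f' := fun y => 1 / (2 * √y)) measurableSet_Ioi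
      (fun y hy => (Real.hasDerivAt_sqrt (ne_of_gt hy)).hasDerivWithinAt)
      (fun a ha b hb hab => (Real.sqrt_inj (le_of_lt ha) (le_of_lt hb)).1 hab) fun x => g (x ^ 2)
    rw [himg] at h
    rw [h]
    refine setLIntegral_congr_fun measurableSet_Ioi fun y hy => ?_
    have hy' : 0 < √y := Real.sqrt_pos.2 hy
    simp only [Real.sq_sqrt (le_of_lt hy)]
    congr 2
    rw [abs_of_pos (by positivity)]
    field_simp
  have hneg : ∫⁻ x in Set.Iic (0 : ℝ), g (x ^ 2) = ∫⁻ x in Set.Ioi (0 : ℝ), g (x ^ 2) := by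
    rw [← restrict_Iio_eq_restrict_Iic, ← lintegral_indicator measurableSet_Iio,
      ← lintegral_indicator measurableSet_Ioi, ← lintegral_neg_eq_self]
    refine lintegral_congr fun x => ?_
    by_cases hx : 0 < x <;> simp [Set.indicator, hx]
  rw [← lintegral_add_compl _ (measurableSet_Ioi (a := (0 : ℝ))), Set.compl_Ioi, hneg, hpos,
    ← two_mul, ← lintegral_const_mul' _ _ (by simp), ← lintegral_indicator measurableSet_Ioi]
  refine lintegral_congr fun y => ?_
  by_cases hy : 0 < y
  · simp only [sqDensity, Set.indicator_of_mem (Set.mem_Ioi.2 hy)]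
    rw [← mul_assoc]
    congr 1
    rw [show (2 : ENNReal) = ENNReal.ofReal 2 by simp, ← ENNReal.ofReal_mul (by norm_num)]
    congr 1
    ring
  · simp [sqDensity, Set.indicator, hy]

theorem measurable_cons {n : ℕ} :
    Measurable fun p : ℝ × (Fin n → ℝ) => (Fin.cons p.1 p.2 : Fin (n + 1) → ℝ) := by
  refine measurable_pi_lambda _ fun i => ?_
  induction i using Fin.cases with
  | zero => simpa using measurable_fst
  | succ i =>
    simp only [Fin.cons_succ]
    exact (measurable_pi_apply i).comp measurable_snd

theorem lintegral_fin_succ {n : ℕ} {G : (Fin (n + 1) → ℝ) → ENNReal} (hG : Measurable G) :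
    ∫⁻ x, G x = ∫⁻ a : ℝ, ∫⁻ y : Fin n → ℝ, G (Fin.cons a y) := by
  have h := (volume_preserving_piFinSuccAbove (fun _ : Fin (n + 1) => ℝ) 0).symm.lintegral_comp hG
  rw [← h, Measure.volume_eq_prod]
  have h2 := lintegral_prod (μ := (volume : Measure ℝ)) (ν := (volume : Measure (Fin n → ℝ)))
    (fun p => G (Fin.cons p.1 p.2)) (hG.comp measurable_cons).aemeasurable
  rw [← h2]
  refine lintegral_congr fun p => ?_
  simp [MeasurableEquiv.piFinSuccAbove_symm_apply, Fin.insertNthEquiv]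

theorem lintegral_comp_sq_pi {n : ℕ} {G : (Fin n → ℝ) → ENNReal} (hG : Measurable G) :
    ∫⁻ x : Fin n → ℝ, G (fun i => x i ^ 2) = ∫⁻ y : Fin n → ℝ, (∏ i, sqDensity (y i)) * G y := by
  induction n with
  | zero =>
    refine lintegral_congr fun x => ?_
    have : (fun i => x i ^ 2) = x := Subsingleton.elim _ _
    simp [this]
  | succ n ih =>
    have hsq : Measurable fun x : Fin (n + 1) → ℝ => fun i => x i ^ 2 := by fun_prop
    have hw : Measurable fun y : Fin (n + 1) → ℝ => ∏ i, sqDensity (y i) :=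
      Finset.measurable_fun_prod _ fun i _ => measurable_sqDensity.comp (measurable_pi_apply i)
    have hGc (a : ℝ) : Measurable fun y : Fin n → ℝ => G (Fin.cons a y) :=
      hG.comp (measurable_cons.comp measurable_prodMk_left)
    rw [lintegral_fin_succ (G := fun x => G fun i => x i ^ 2) (hG.comp hsq),
      lintegral_fin_succ (G := fun y => (∏ i, sqDensity (y i)) * G y) (hw.mul hG)]
    have hcons (a : ℝ) (y : Fin n → ℝ) : (fun i => (Fin.cons a y : Fin (n + 1) → ℝ) i ^ 2) =
        Fin.cons (a ^ 2) fun i => y i ^ 2 := by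
      ext i
      induction i using Fin.cases <;> simp
    simp only [hcons]
    have h1 (a : ℝ) := ih (hGc (a ^ 2))
    simp only [h1]
    rw [lintegral_comp_sq fun a => ∫⁻ y : Fin n → ℝ, (∏ i, sqDensity (y i)) * G (Fin.cons a y)]
    refine lintegral_congr fun a => ?_
    have hw' : Measurable fun y : Fin n → ℝ => ∏ i, sqDensity (y i) :=
      Finset.measurable_fun_prod _ fun i _ => measurable_sqDensity.comp (measurable_pi_apply i)
    rw [← lintegral_const_mul
      (f := fun y : Fin n → ℝ => (∏ i, sqDensity (y i)) * G (Fin.cons a y)) _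
      (hw'.mul (hGc a))]
    simp [Fin.prod_univ_succ, mul_assoc]

/-- The residues sum to the leading coefficient, because the numerator has degree one less than the
denominator. -/
theorem sum_residueMap {lam : Fin (m + 1) → ℝ} (hlam : StrictMono lam) (z : Fin (m + 1) → ℝ) :
    ∑ i, residueMap lam z i = z 0 := by
  have hdeg : (rootPoly z).degree < ((Finset.univ : Finset (Fin (m + 1))).card : WithBot ℕ) := by
    refine degree_le_natDegree.trans_lt ?_
    rw [Finset.card_fin]
    exact_mod_cast Nat.lt_succ_of_le (natDegree_rootPoly_le z)
  have h := Lagrange.coeff_eq_sum hlam.injective.injOn hdeg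
  rw [Finset.card_fin, Nat.add_sub_cancel, coeff_rootPoly] at h
  rw [h]
  refine Finset.sum_congr rfl fun i _ => ?_
  rw [residueMap, nodeDeriv, ← Finset.compl_singleton, ← Fin.image_succAbove_univ,
    Finset.prod_image fun a _ b _ h => Fin.succAbove_right_injective h]

theorem prod_sqrt_residueMap {lam : Fin (m + 1) → ℝ} (hlam : StrictMono lam)
    {z : Fin (m + 1) → ℝ} (hz : z ∈ residueDomain lam) :
    ∏ i, √(residueMap lam z i) = √(z 0) ^ (m + 1) *
      (∏ i : Fin (m + 1), ∏ j : Fin m, |lam i - z j.succ| ^ (1 / 2 : ℝ)) / absVandermonde lam := by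
  have h (i : Fin (m + 1)) : √(residueMap lam z i) =
      √(z 0) * (∏ j : Fin m, |lam i - z j.succ| ^ (1 / 2 : ℝ)) / √|nodeDeriv lam i| := by
    rw [← abs_of_pos (residueMap_pos hlam hz i), residueMap, eval_rootPoly, abs_div, abs_mul,
      abs_of_pos hz.1, Real.sqrt_div (mul_nonneg hz.1.le (abs_nonneg _)), Real.sqrt_mul hz.1.le,
      Finset.abs_prod,
      Real.sqrt_eq_rpow (∏ j, _), Real.finsetProd_rpow _ _ fun _ _ => abs_nonneg _]
  simp only [h]
  rw [Finset.prod_div_distrib, Finset.prod_mul_distrib, Finset.prod_const, Finset.card_fin]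
  congr 1
  have : ∏ i, √|nodeDeriv lam i| = √(∏ i, |nodeDeriv lam i|) := by
    simp only [Real.sqrt_eq_rpow]
    rw [Real.finsetProd_rpow _ _ fun _ _ => abs_nonneg _]
  rw [this, prod_abs_nodeDeriv, Real.sqrt_sq (absVandermonde_pos hlam.injective).le]

/-! ### The change of variables on the unit ball -/

theorem interlacing_injective {lam : Fin (m + 1) → ℝ} (hlam : StrictMono lam) {μ : Fin m → ℝ}
    (hμ : μ ∈ interlacing lam) : Function.Injective μ :=
  fun a _ h => interlacing_eq_of_mem_gap hlam hμ (hμ a) h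

/-- All powers of the Vandermonde product of `lam` cancel between the Jacobian of `residueMap` and
the density of the squared coordinates. -/
theorem abs_det_residueJacobian_mul {lam : Fin (m + 1) → ℝ} (hlam : StrictMono lam)
    {z : Fin (m + 1) → ℝ} (hz : z ∈ residueDomain lam) :
    |(residueJacobian lam z).det| * ∏ i, (√(residueMap lam z i))⁻¹ =
      z 0 ^ m / √(z 0) ^ (m + 1) * weight lam fun j => z j.succ := by
  have hV := absVandermonde_pos hlam.injective
  have hs : 0 < √(z 0) := Real.sqrt_pos.2 hz.1
  rw [abs_det_residueJacobian hlam hz.1 (interlacing_injective hlam hz.2), Finset.prod_inv_distrib,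
    prod_sqrt_residueMap hlam hz, weight, absVandermonde]
  field_simp

theorem measurable_weight (lam : Fin (m + 1) → ℝ) : Measurable (weight lam) := by
  unfold weight
  fun_prop

theorem measurableSet_interlacing (lam : Fin (m + 1) → ℝ) : MeasurableSet (interlacing lam) := by
  have : interlacing lam = ⋂ j : Fin m, {μ | lam j.castSucc < μ j} ∩ {μ | μ j < lam j.succ} := by
    ext μ; simp [interlacing]
  rw [this]
  exact MeasurableSet.iInter fun j =>
    (measurableSet_lt measurable_const (measurable_pi_apply j)).inter
      (measurableSet_lt (measurable_pi_apply j) measurable_const)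

/-- The radial integral `∫₀¹ s ^ (m - (m + 1) / 2) ds`. -/
noncomputable def radialConst (m : ℕ) : ENNReal :=
  ∫⁻ s in Set.Ioc (0 : ℝ) 1, ENNReal.ofReal (s ^ m / √s ^ (m + 1))

theorem radialConst_ne_zero (m : ℕ) : radialConst m ≠ 0 := by
  have hmeas : Measurable fun s : ℝ => ENNReal.ofReal (s ^ m / √s ^ (m + 1)) := by fun_prop
  refine ((setLIntegral_pos_iff hmeas).2 ?_).ne'
  refine lt_of_lt_of_le ?_ (measure_mono (s := Set.Ioc 0 1) fun s hs => ⟨?_, hs⟩)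
  · simp
  · have h0 := hs.1
    have h1 : 0 < √s := Real.sqrt_pos.2 h0
    simp only [Function.mem_support, ne_eq, ENNReal.ofReal_eq_zero, not_le]
    positivity

theorem radialConst_ne_top {m : ℕ} (hm : 1 ≤ m) : radialConst m ≠ ⊤ := by
  refine ne_top_of_le_ne_top (b := ∫⁻ s in Set.Ioc (0 : ℝ) 1, 1) (by simp)
    (setLIntegral_mono measurable_const fun s hs => ?_)
  rw [ENNReal.ofReal_le_one]
  have h1 : 0 < √s := Real.sqrt_pos.2 hs.1
  rw [div_le_one (by positivity)]
  -- In terms of `√s ≤ 1`, the claim is `(√s) ^ (2 m) ≤ (√s) ^ (m + 1)`.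
  conv_lhs => rw [← Real.sq_sqrt hs.1.le, ← pow_mul]
  exact pow_le_pow_of_le_one h1.le (Real.sqrt_le_one.2 hs.2) (by omega)

/-- Integration over the unit ball in the coordinates `x i ^ 2 = residueMap lam (s, μ) i`. -/
theorem lintegral_unitBall_residue {lam : Fin (m + 1) → ℝ} (hlam : StrictMono lam)
    {φ : (Fin m → ℝ) → ENNReal} (hφ : Measurable φ) {G : (Fin (m + 1) → ℝ) → ENNReal}
    (hG : Measurable G)
    (hGφ : ∀ z ∈ residueDomain lam, G (residueMap lam z) = φ fun j => z j.succ) :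
    ∫⁻ x in unitBall (m + 1), G (fun i => x i ^ 2) =
      radialConst m * ∫⁻ μ in interlacing lam, φ μ * ENNReal.ofReal (weight lam μ) := by
  set S : Set (Fin (m + 1) → ℝ) := {y | ∑ i, y i ≤ 1} with hS
  have hSm : MeasurableSet S := measurableSet_le (by fun_prop) measurable_const
  set T : Set (Fin (m + 1) → ℝ) := {y | ∀ i, 0 < y i} with hT
  have hTm : MeasurableSet T := by
    have : T = ⋂ i, {y | 0 < y i} := by ext y; simp [hT]
    rw [this]
    exact MeasurableSet.iInter fun i => measurableSet_lt measurable_const (measurable_pi_apply i)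
  -- Since the residues sum to `s`, the unit ball becomes the condition `s ≤ 1`.
  set r : ℝ → ENNReal :=
    (Set.Ioc 0 1).indicator fun s => ENNReal.ofReal (s ^ m / √s ^ (m + 1)) with hr
  have hrm : Measurable r := Measurable.indicator (by fun_prop) measurableSet_Ioc
  set ψ : (Fin m → ℝ) → ENNReal :=
    (interlacing lam).indicator fun μ => φ μ * ENNReal.ofReal (weight lam μ) with hψ
  have hψm : Measurable ψ :=
    (hφ.mul (measurable_weight lam).ennreal_ofReal).indicator (measurableSet_interlacing lam)
  have htail : Measurable fun z : Fin (m + 1) → ℝ => fun j : Fin m => z j.succ := by fun_prop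
  calc ∫⁻ x in unitBall (m + 1), G (fun i => x i ^ 2)
      = ∫⁻ x : Fin (m + 1) → ℝ, S.indicator G fun i => x i ^ 2 := by
        rw [← lintegral_indicator (measurableSet_unitBall _)]
        refine lintegral_congr fun x => ?_
        by_cases hx : ∑ i, x i ^ 2 ≤ 1 <;> simp [Set.indicator, unitBall, hS, hx]
    _ = ∫⁻ y : Fin (m + 1) → ℝ, (∏ i, sqDensity (y i)) * S.indicator G y :=
        lintegral_comp_sq_pi (hG.indicator hSm)
    _ = ∫⁻ y in T, ENNReal.ofReal (∏ i, (√(y i))⁻¹) * S.indicator G y := by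
        rw [← lintegral_indicator hTm]
        refine lintegral_congr fun y => ?_
        by_cases hy : y ∈ T
        · rw [Set.indicator_of_mem hy, ENNReal.ofReal_prod_of_nonneg fun i _ => by positivity]
          congr 1
          exact Finset.prod_congr rfl fun i _ => Set.indicator_of_mem (Set.mem_Ioi.2 (hy i)) _
        · rw [Set.indicator_of_notMem hy]
          obtain ⟨i, hi⟩ := not_forall.1 hy
          have hi0 : sqDensity (y i) = 0 := Set.indicator_of_notMem hi _
          rw [Finset.prod_eq_zero (Finset.mem_univ i) hi0, zero_mul]
    _ = ∫⁻ z in residueDomain lam, ENNReal.ofReal |(residueJacobian lam z).det| *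
          (ENNReal.ofReal (∏ i, (√(residueMap lam z i))⁻¹) * S.indicator G (residueMap lam z)) := by
        rw [hT, ← image_residueMap hlam, lintegral_image_eq_lintegral_abs_det_fderiv_mul volume
          (isOpen_residueDomain lam).measurableSet
          (fun z _ => (hasFDerivAt_residueMap lam z).hasFDerivWithinAt) (residueMap_injOn hlam)]
        refine lintegral_congr fun z => ?_
        rw [ContinuousLinearMap.det, LinearMap.coe_toContinuousLinearMap, LinearMap.det_toLin']
    _ = ∫⁻ z : Fin (m + 1) → ℝ, r (z 0) * ψ fun j => z j.succ := by
        rw [← lintegral_indicator (isOpen_residueDomain lam).measurableSet]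
        refine lintegral_congr fun z => ?_
        by_cases hz : z ∈ residueDomain lam
        · rw [Set.indicator_of_mem hz, ← mul_assoc, ← ENNReal.ofReal_mul (abs_nonneg _),
            abs_det_residueJacobian_mul hlam hz, hψ, Set.indicator_of_mem hz.2]
          have hs : 0 < z 0 := hz.1
          have hzS : residueMap lam z ∈ S ↔ z 0 ≤ 1 := by
            rw [hS, Set.mem_ofPred_eq, sum_residueMap hlam]
          by_cases h1 : z 0 ≤ 1
          · have hr1 : r (z 0) = ENNReal.ofReal (z 0 ^ m / √(z 0) ^ (m + 1)) :=
              Set.indicator_of_mem (s := Set.Ioc (0 : ℝ) 1) ⟨hs, h1⟩ _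
            rw [hr1, Set.indicator_of_mem (hzS.2 h1), hGφ z hz, ENNReal.ofReal_mul (by positivity)]
            ring
          · have hr1 : r (z 0) = 0 :=
              Set.indicator_of_notMem (s := Set.Ioc (0 : ℝ) 1) (fun h => h1 h.2) _
            rw [hr1, Set.indicator_of_notMem (mt hzS.1 h1), mul_zero, zero_mul]
        · rw [Set.indicator_of_notMem hz]
          by_cases h0 : 0 < z 0
          · have hψ0 : ψ (fun j => z j.succ) = 0 := Set.indicator_of_notMem (fun h => hz ⟨h0, h⟩) _
            rw [hψ0, mul_zero]
          · have hr1 : r (z 0) = 0 :=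
              Set.indicator_of_notMem (s := Set.Ioc (0 : ℝ) 1) (fun h => h0 h.1) _
            rw [hr1, zero_mul]
    _ = _ := by
        rw [lintegral_fin_succ (G := fun z => r (z 0) * ψ fun j => z j.succ)
          ((hrm.comp (measurable_pi_apply 0)).mul (hψm.comp htail))]
        simp only [Fin.cons_zero, Fin.cons_succ, lintegral_const_mul _ hψm]
        rw [lintegral_mul_const _ hrm, hr, hψ, lintegral_indicator measurableSet_Ioc,
          lintegral_indicator (measurableSet_interlacing lam)]
        rfl

/-! ### The law of the corner -/

/-- Almost surely no entry of the last row vanishes. -/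
theorem ae_last_row_ne_zero (hm : 1 ≤ m) :
    ∀ᵐ k : SO (m + 1) ∂haarSO (m + 1),
      ∀ i, (k : Matrix (Fin (m + 1)) (Fin (m + 1)) ℝ) (Fin.last m) i ≠ 0 := by
  set Z : Set (Fin (m + 1) → ℝ) := {x | ∃ i, x i = 0} with hZ
  have hZU : Z = ⋃ i, {x | x i = 0} := by ext x; simp [hZ]
  have hZm : MeasurableSet Z := by
    rw [hZU]
    exact MeasurableSet.iUnion fun i =>
      measurableSet_eq_fun (measurable_pi_apply i) measurable_const
  have hZ0 : volume Z = 0 := by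
    rw [hZU, measure_iUnion_null_iff]
    intro i
    rw [volume_pi]
    exact Measure.pi_hyperplane _ i 0
  have h := setLIntegral_unitBall_eq hm (G := Z.indicator 1) (measurable_one.indicator hZm)
    fun t ht x => by simp [Set.indicator, hZ, ht.ne']
  have h0 : ∫⁻ x in unitBall (m + 1), Z.indicator 1 x = 0 := by
    refine le_antisymm ((setLIntegral_le_lintegral _ _).trans ?_) zero_le
    rw [lintegral_indicator_one hZm, hZ0]
  rw [h0, eq_comm, mul_eq_zero, or_iff_right (volume_unitBall_ne_zero _)] at h
  have hmeas : Measurable fun k : SO (m + 1) => Z.indicator (1 : (Fin (m + 1) → ℝ) → ENNReal)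
      ((k : Matrix (Fin (m + 1)) (Fin (m + 1)) ℝ) (Fin.last m)) :=
    (measurable_one.indicator hZm).comp (continuous_SO_row _).measurable
  filter_upwards [(lintegral_eq_zero_iff hmeas).1 h] with k hk i hi
  have : (k : Matrix (Fin (m + 1)) (Fin (m + 1)) ℝ) (Fin.last m) ∈ Z := ⟨i, hi⟩
  rw [Set.indicator_of_mem this] at hk
  exact one_ne_zero hk

/-- If the squared last row of `k` is `residueMap lam (s, μ)`, then the corner of `k.lam` is
conjugate to `diag μ`. -/
theorem block_act_mem_orbit (hm : 1 ≤ m) {lam : Fin (m + 1) → ℝ} (hlam : StrictMono lam)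
    {k : SO (m + 1)} {z : Fin (m + 1) → ℝ} (hz : z ∈ residueDomain lam)
    (h : residueMap lam z =
      fun i => (k : Matrix (Fin (m + 1)) (Fin (m + 1)) ℝ) (Fin.last m) i ^ 2) :
    ∃ l : SO m, block (act k (diag lam)) = act l (diag fun j => z j.succ) := by
  set B := block (act k (diag lam)) with hB
  have hdeg : B.1.charpoly.natDegree = m := by
    rw [Matrix.charpoly_natDegree_eq_dim, Fintype.card_fin]
  have hp : B.1.charpoly = rootPoly z := by
    refine rootPoly_eq_of_residueMap_eq hlam hdeg.le fun i => ?_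
    rw [hB, eval_charpoly_block, h, nodeDeriv]
  have hz0 : z 0 = 1 := by
    have hmon := B.1.charpoly_monic.coeff_natDegree
    rwa [hdeg, hp, coeff_rootPoly] at hmon
  refine exists_act_diag_of_charpoly_eq hm B (interlacing_injective hlam hz.2) ?_
  rw [hp, rootPoly, hz0, C_1, one_mul]

theorem continuous_residueMap (lam : Fin (m + 1) → ℝ) : Continuous (residueMap lam) :=
  continuous_iff_continuousAt.2 fun z => (hasFDerivAt_residueMap lam z).continuousAt

theorem measurable_diag (n : ℕ) : Measurable (diag : (Fin n → ℝ) → SymMat n) := by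
  have : Continuous (diag : (Fin n → ℝ) → SymMat n) :=
    Continuous.subtype_mk (continuous_id.matrix_diagonal) _
  exact this.measurable

/-- A function of `μ` becomes, through the inverse of `residueMap`, a measurable function of the
residues that is homogeneous of degree zero. -/
theorem exists_homogeneous_extension {lam : Fin (m + 1) → ℝ} (hlam : StrictMono lam)
    {φ : (Fin m → ℝ) → ENNReal} (hφ : Measurable φ) :
    ∃ G : (Fin (m + 1) → ℝ) → ENNReal, Measurable G ∧
      (∀ z ∈ residueDomain lam, G (residueMap lam z) = φ fun j => z j.succ) ∧
      ∀ t : ℝ, 0 < t → ∀ y, G (t • y) = G y := by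
  have hemb : MeasurableEmbedding ((residueDomain lam).domRestrict (residueMap lam)) :=
    ContinuousOn.measurableEmbedding (isOpen_residueDomain lam).measurableSet
      (continuous_residueMap lam).continuousOn (residueMap_injOn hlam)
  have htail : Measurable fun z : residueDomain lam => φ fun j : Fin m => z.1 j.succ :=
    hφ.comp (measurable_pi_lambda _ fun j =>
      (measurable_pi_apply _).comp measurable_subtype_coe)
  obtain ⟨G₀, hG₀, hcomp⟩ := hemb.exists_measurable_extend htail fun _ => ⟨0⟩
  -- `T` is the image of `residueMap`; outside it `G₀` is arbitrary and is replaced by zero.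
  set T : Set (Fin (m + 1) → ℝ) := {y | ∀ i, 0 < y i} with hT
  have hTm : MeasurableSet T := by
    have := hemb.measurableSet_range
    rwa [Set.range_domRestrict, image_residueMap hlam] at this
  have hval : ∀ z ∈ residueDomain lam, T.indicator G₀ (residueMap lam z) = φ fun j => z j.succ := by
    intro z hz
    rw [Set.indicator_of_mem (show residueMap lam z ∈ T from residueMap_pos hlam hz)]
    exact congrFun hcomp ⟨z, hz⟩
  refine ⟨T.indicator G₀, hG₀.indicator hTm, hval, fun t ht y => ?_⟩
  by_cases hy : y ∈ T
  · obtain ⟨z, hz, rfl⟩ := residueMap_surjOn hlam hy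
    set w : Fin (m + 1) → ℝ := Fin.cons (t * z 0) fun j => z j.succ with hw
    have hwz : t • residueMap lam z = residueMap lam w := by
      ext i
      simp only [Pi.smul_apply, smul_eq_mul, residueMap, eval_rootPoly, hw, Fin.cons_zero,
        Fin.cons_succ]
      ring
    have hwU : w ∈ residueDomain lam :=
      ⟨by simpa [hw] using mul_pos ht hz.1, by simpa [hw] using hz.2⟩
    rw [hwz, hval w hwU, hval z hz]
    simp [hw]
  · have hty : t • y ∉ T := fun h => hy fun i => pos_of_mul_pos_right (h i) ht.le
    rw [Set.indicator_of_notMem hy, Set.indicator_of_notMem hty]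

/-- The corner integral of a `[0, ∞]`-valued measurable function, with explicit constants. -/
theorem volume_mul_lintegral_block (hm : 1 ≤ m) {lam : Fin (m + 1) → ℝ} (hlam : StrictMono lam)
    {g : SymMat m → ENNReal} (hg : Measurable g) :
    volume (unitBall (m + 1)) * ∫⁻ k, g (block (act k (diag lam))) ∂haarSO (m + 1) =
      radialConst m * ∫⁻ μ in interlacing lam,
        orbitAverage g (diag μ) * ENNReal.ofReal (weight lam μ) := by
  have hφ : Measurable fun μ => orbitAverage g (diag μ) :=
    (measurable_orbitAverage hg).comp (measurable_diag m)
  obtain ⟨G, hG, hGφ, hGhom⟩ := exists_homogeneous_extension hlam hφ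
  have hsq : Measurable fun x : Fin (m + 1) → ℝ => fun i => x i ^ 2 := by fun_prop
  rw [← lintegral_unitBall_residue hlam hφ hG hGφ,
    setLIntegral_unitBall_eq hm (G := fun x => G fun i => x i ^ 2) (hG.comp hsq) fun t ht x =>
      (congrArg G (by ext i; simp [mul_pow])).trans
        (hGhom (t ^ 2) (by positivity) fun i => x i ^ 2),
    ← lintegral_orbitAverage_block hg]
  congr 1
  refine lintegral_congr_ae ?_
  filter_upwards [ae_last_row_ne_zero hm] with k hk
  obtain ⟨z, hz, hzk⟩ := residueMap_surjOn hlam fun i => sq_pos_of_ne_zero (hk i)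
  obtain ⟨l, hl⟩ := block_act_mem_orbit hm hlam hz hzk
  rw [hl, orbitAverage_act, ← hzk, hGφ z hz]

end Corner

theorem mainTheorem4 (m : ℕ) (hm : 1 ≤ m) :
    ∃ c : ℝ, 0 < c ∧
      ∀ lam : Fin (m + 1) → ℝ, StrictMono lam →
        ∀ f : Corner.SymMat m → ℝ, Measurable f → (∀ X, 0 ≤ f X) →
          ∫⁻ k : Corner.SO (m + 1),
              ENNReal.ofReal (f (Corner.block (Corner.act k (Corner.diag lam))))
              ∂(Corner.haarSO (m + 1)) =
            ENNReal.ofReal c *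
              ∫⁻ μ in Corner.interlacing lam,
                (∫⁻ k' : Corner.SO m,
                    ENNReal.ofReal (f (Corner.act k' (Corner.diag μ)))
                    ∂(Corner.haarSO m)) *
                  ENNReal.ofReal (Corner.weight lam μ) := by
  have hv0 := Corner.volume_unitBall_ne_zero (m + 1)
  have hv1 := Corner.volume_unitBall_ne_top (m + 1)
  have hr0 := Corner.radialConst_ne_zero m
  have hr1 := Corner.radialConst_ne_top hm
  have hc : Corner.radialConst m / volume (Corner.unitBall (m + 1)) ≠ ⊤ :=
    ENNReal.div_ne_top hr1 hv0
  refine ⟨(Corner.radialConst m / volume (Corner.unitBall (m + 1))).toReal,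
    ENNReal.toReal_pos (ENNReal.div_ne_zero.2 ⟨hr0, hv1⟩) hc, fun lam hlam f hf _ => ?_⟩
  have h := Corner.volume_mul_lintegral_block hm hlam hf.ennreal_ofReal
  rw [ENNReal.ofReal_toReal hc, ENNReal.div_eq_inv_mul, mul_assoc]
  refine Eq.trans ?_ (congrArg (_ * ·) h)
  rw [← mul_assoc, ENNReal.inv_mul_cancel hv0 hv1, one_mul]
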